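/- Let $d\ge 2$ and let $X=(X_1,\dots,X_d)$ be a random vector with a multivariate normal distribution $N(0,\Sigma)$, where $\Sigma=(\rho_{ij})_{1\le i,j\le d}$ with $\rho_{ii}=1$ for all $i$ and $-1<\rho_{ij}<0$ for all $i\ne j$. Let $\Phi$ be the standard normal distribution function and let $C$ be the normal (Gaussian) copula, i.e. the distribution function $C(u)=P(\Phi(X_1)\le u_1,\dots,\Phi(X_d)\le u_d)$ of $(\Phi(X_1),\dots,\Phi(X_d))$. A norm $\|\cdot\|_D$ on $\mathbb{R}^d$ is a $D$-norm if some copula $C'$ satisfies $C'(u)=1-\|u-\mathbf 1\|_D+o(\|u-\mathbf 1\|_D)$ uniformly for $u\in[0,1]^d$ as $u\to\mathbf 1=(1,\dots,1)$. A generalized Pareto copula (GPC) with $D$-norm $\|\cdot\|_D$ is a copula $C_D$ such that, for some $u_0\in[0,1)^d$, $C_D(u)=1-\|u-\mathbf 1\|_D$ for all $u$ with $u_0\le u\le \mathbf 1$ componentwise. A copula $C$ is in the $\delta$-neighborhood of a GPC with $D$-norm $\|\cdot\|_D$ if $\delta>0$ and $$C(u)-\bigl(1-\|u-\mathbf 1\|_D\bigr)=O\bigl(\|u-\mathbf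 1\|_D^{1+\delta}\bigr)$$ uniformly for $u\in[0,1]^d$ as $u\to\mathbf 1$. Then $C$ is in the $\delta$-neighborhood of a GPC with $D$-norm $\|x\|_1=\sum_{i=1}^d|x_i|$ (in particular $C$ is a copula, $\|\cdot\|_1$ is a $D$-norm and such a GPC exists), where $$\delta=\min_{1\le i\ne j\le d}\frac{\rho_{ij}^2}{1-\rho_{ij}^2}.$$ -/

import Mathlib

open MeasureTheory ProbabilityTheory Filter Topology Asymptotics

/-- `C` is a `d`-dimensional copula: the distribution function of a probability measure on `ℝ^d`
all of whose one-dimensional margins are uniform on the unit interval. -/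
def IsCopula {d : ℕ} (C : (Fin d → ℝ) → ℝ) : Prop :=
  ∃ μ : Measure (Fin d → ℝ), IsProbabilityMeasure μ ∧
    (∀ i, μ.map (fun x => x i) = volume.restrict (Set.Icc (0 : ℝ) 1)) ∧
    ∀ u, C u = μ.real (Set.Iic u)

/-- The remainder `r(u) = C(u) - (1 - ‖u - 1‖)` of the expansion of `C` at `(1, …, 1)` with
respect to the (semi)norm `N`. -/
def expansionRemainder {d : ℕ} (C : (Fin d → ℝ) → ℝ) (N : Seminorm ℝ (Fin d → ℝ))
    (u : Fin d → ℝ) : ℝ :=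
  C u - (1 - N (u - 1))

/-- `N` is a `D`-norm: a norm on `ℝ^d` for which some copula satisfies
`C(u) = 1 - ‖u - 1‖ + o(‖u - 1‖)`, uniformly for `u ∈ [0,1]^d`, as `u` tends to `(1, …, 1)`. -/
def IsDNorm {d : ℕ} (N : Seminorm ℝ (Fin d → ℝ)) : Prop :=
  (∀ x, N x = 0 → x = 0) ∧
    ∃ C : (Fin d → ℝ) → ℝ, IsCopula C ∧
      expansionRemainder C N =o[𝓝[Set.Icc 0 1] 1] fun u => N (u - 1)

/-- `C` is a generalized Pareto copula with `D`-norm `N`: a copula that is equal to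
`1 - ‖u - 1‖_D` for all `u` in a box `[u₀, 1]` with `u₀ ∈ [0,1)^d`. -/
def IsGPC {d : ℕ} (C : (Fin d → ℝ) → ℝ) (N : Seminorm ℝ (Fin d → ℝ)) : Prop :=
  IsCopula C ∧ IsDNorm N ∧
    ∃ u₀ : Fin d → ℝ, (∀ i, 0 ≤ u₀ i ∧ u₀ i < 1) ∧ ∀ u ∈ Set.Icc u₀ 1, C u = 1 - N (u - 1)

/-- The copula `C` is in the `δ`-neighborhood of a generalized Pareto copula with `D`-norm `N`:
`δ > 0` and `C(u) - (1 - ‖u - 1‖_D) = O(‖u - 1‖_D ^ (1 + δ))`, uniformly for `u ∈ [0,1]^d`,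
as `u` tends to `(1, …, 1)`. -/
def InDeltaNeighborhood {d : ℕ} (C : (Fin d → ℝ) → ℝ) (N : Seminorm ℝ (Fin d → ℝ)) (δ : ℝ) :
    Prop :=
  IsCopula C ∧ (∃ C_D : (Fin d → ℝ) → ℝ, IsGPC C_D N) ∧ 0 < δ ∧
    expansionRemainder C N =O[𝓝[Set.Icc 0 1] 1] fun u => N (u - 1) ^ (1 + δ)

/-- The norm `‖x‖₁ = ∑ i, |x i|` on `ℝ^d`. -/
noncomputable def l1Norm (d : ℕ) : Seminorm ℝ (Fin d → ℝ) :=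
  Seminorm.of (fun x => ∑ i, |x i|)
    (fun x y => by
      rw [← Finset.sum_add_distrib]
      exact Finset.sum_le_sum fun i _ => abs_add_le (x i) (y i))
    (fun a x => by simp [abs_mul, Finset.mul_sum])

/-- The standard normal distribution function `Φ`. -/
noncomputable def stdNormalCDF (x : ℝ) : ℝ :=
  cdf (gaussianReal 0 1) x

/-! By Bonferroni, C(u) - (1 - ‖u - 1‖₁) lies between 0 and the sum over i ≠ j of P(U_i > u_i, U_j >
u_j), where U_i = Φ(X_i) (`expansionRemainder_l1Norm_mem_Icc`). For correlation r, the Chernoff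
bound for X_i + X_j, of variance 2(1 + r), gives P(X_i > s, X_j > s) ≤ exp(-s²/(1 + r)). Since r <
0, this is at most exp(-s²) to the power 1/(1 - r²) = 1 + r²/(1 - r²), and exp(-s²) is at most a
constant times 1 - Φ(s). Taking the smallest exponent over all pairs yields δ.

The GPC comes from equally spaced rotations of one uniform variable: two coordinates never exceed 1
- 1/d together, so the Bonferroni error vanishes near (1, …, 1). -/

/-! ### The standard normal distribution function and its tail. -/

theorem stdNormalCDF_eq_real (x : ℝ) :
    stdNormalCDF x = (gaussianReal 0 1).real (Set.Iic x) :=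
  cdf_eq_real _ x

theorem strictMono_stdNormalCDF : StrictMono stdNormalCDF := by
  intro x y hxy
  have hpos : 0 < (gaussianReal 0 1).real (Set.Ioc x y) := by
    refine ENNReal.toReal_pos (fun h => ?_) (measure_ne_top _ _)
    have := gaussianReal_absolutelyContinuous' 0 one_ne_zero h
    simp only [Real.volume_Ioc, ENNReal.ofReal_eq_zero] at this
    linarith
  rw [stdNormalCDF_eq_real, stdNormalCDF_eq_real, ← Set.Iic_union_Ioc_eq_Iic hxy.le,
    measureReal_union (Set.Iic_disjoint_Ioc le_rfl) measurableSet_Ioc]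
  linarith

theorem continuous_stdNormalCDF : Continuous stdNormalCDF := by
  have : NullSingletonClass (gaussianReal 0 1) := nullSingletonClass_gaussianReal one_ne_zero
  refine continuous_iff_continuousAt.2 fun x => ?_
  have hmono : Monotone (cdf (gaussianReal 0 1)) := monotone_cdf _
  have h : (cdf (gaussianReal 0 1)).measure {x} = 0 := by
    rw [measure_cdf]; exact measure_singleton x
  rw [StieltjesFunction.measure_singleton, ENNReal.ofReal_eq_zero] at h
  refine hmono.continuousAt_iff_leftLim_eq_rightLim.2 ?_
  rw [StieltjesFunction.rightLim_eq]
  exact le_antisymm (hmono.leftLim_le le_rfl) (by linarith)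

theorem stdNormalCDF_pos (x : ℝ) : 0 < stdNormalCDF x :=
  (cdf_nonneg _ (x - 1)).trans_lt (strictMono_stdNormalCDF (by linarith))

theorem stdNormalCDF_lt_one (x : ℝ) : stdNormalCDF x < 1 :=
  (strictMono_stdNormalCDF (lt_add_one x)).trans_le (cdf_le_one _ (x + 1))

theorem exists_stdNormalCDF_eq {t : ℝ} (h0 : 0 < t) (h1 : t < 1) :
    ∃ s, stdNormalCDF s = t := by
  obtain ⟨a, ha⟩ := ((tendsto_cdf_atBot (gaussianReal 0 1)).eventually_lt_const h0).exists
  obtain ⟨b, hb⟩ := ((tendsto_cdf_atTop (gaussianReal 0 1)).eventually_const_lt h1).exists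
  exact mem_range_of_exists_le_of_exists_ge continuous_stdNormalCDF ⟨a, ha.le⟩ ⟨b, hb.le⟩

/-- A crude lower bound for the upper tail of the standard normal distribution. -/
theorem exists_mul_exp_le_one_sub_stdNormalCDF :
    ∃ c : ℝ, 0 < c ∧ ∀ s, 0 ≤ s → c * Real.exp (-s ^ 2) ≤ 1 - stdNormalCDF s := by
  refine ⟨(√(2 * Real.pi))⁻¹ * Real.exp (-1), by positivity, fun s hs => ?_⟩
  have h1 : 1 - stdNormalCDF s = (gaussianReal 0 1).real (Set.Ioi s) := by
    rw [stdNormalCDF_eq_real, ← Set.compl_Iic, probReal_compl_eq_one_sub measurableSet_Iic]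
  have h2 : (gaussianReal 0 1).real (Set.Ioc s (s + 1)) =
      ∫ x in Set.Ioc s (s + 1), gaussianPDFReal 0 1 x := by
    rw [measureReal_def, gaussianReal_apply_eq_integral 0 one_ne_zero,
      ENNReal.toReal_ofReal (integral_nonneg fun x => gaussianPDFReal_nonneg _ _ _)]
  have h3 : ∫ _ in Set.Ioc s (s + 1), (√(2 * Real.pi))⁻¹ * Real.exp (-1) * Real.exp (-s ^ 2) ≤
      ∫ x in Set.Ioc s (s + 1), gaussianPDFReal 0 1 x := by
    refine setIntegral_mono_on (integrableOn_const (by simp))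
      (integrable_gaussianPDFReal 0 1).integrableOn measurableSet_Ioc fun x hx => ?_
    rw [gaussianPDFReal, mul_assoc, ← Real.exp_add]
    simp only [NNReal.coe_one, mul_one, sub_zero]
    gcongr
    -- On (s, s + 1], x² ≤ (s + 1)² ≤ 2s² + 2.
    nlinarith [hx.1, hx.2, sq_nonneg (s - 1)]
  rw [h1]
  refine le_trans ?_ (measureReal_mono (Set.Ioc_subset_Ioi_self : Set.Ioc s (s + 1) ⊆ Set.Ioi s))
  rw [h2]
  simpa using h3

/-! ### Bonferroni bounds and the ℓ¹ expansion of a copula. -/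

/-- The points lying in exactly one A i form disjoint sets B i, and A i is covered by B i and its
intersections with the others. Counting each pair twice avoids ordering the indices and costs only a
constant. -/
theorem sum_measureReal_sub_le_measureReal_iUnion {α ι : Type*} [MeasurableSpace α] [Fintype ι]
    [DecidableEq ι] (μ : Measure α) [IsFiniteMeasure μ] (A : ι → Set α)
    (hA : ∀ i, MeasurableSet (A i)) :
    ∑ i, μ.real (A i) - ∑ i, ∑ j ∈ Finset.univ.erase i, μ.real (A i ∩ A j) ≤
      μ.real (⋃ i, A i) := by
  let B : ι → Set α := fun i => A i \ ⋃ j ∈ Finset.univ.erase i, A j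
  have hB : ∀ i, MeasurableSet (B i) := fun i =>
    (hA i).diff (Finset.measurableSet_biUnion _ fun j _ => hA j)
  have hdisj : Pairwise (Function.onFun Disjoint B) := by
    intro i j hij
    refine Set.disjoint_left.2 fun x hxi hxj => hxj.2 ?_
    exact Set.mem_biUnion (Finset.mem_erase.2 ⟨hij, Finset.mem_univ i⟩) hxi.1
  have h1 : ∀ i, μ.real (A i) ≤
      μ.real (B i) + ∑ j ∈ Finset.univ.erase i, μ.real (A i ∩ A j) := by
    intro i
    have hsub : A i ⊆ B i ∪ ⋃ j ∈ Finset.univ.erase i, A i ∩ A j := by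
      intro x hx
      by_cases h : x ∈ ⋃ j ∈ Finset.univ.erase i, A j
      · right
        simp only [Set.mem_iUnion] at h ⊢
        obtain ⟨j, hj, hxj⟩ := h
        exact ⟨j, hj, hx, hxj⟩
      · exact Or.inl ⟨hx, h⟩
    exact (measureReal_mono hsub).trans <| (measureReal_union_le _ _).trans <|
      add_le_add_right (measureReal_biUnion_finset_le _ _) _
  have h2 : ∑ i, μ.real (B i) ≤ μ.real (⋃ i, A i) := by
    rw [← measureReal_iUnion_fintype hdisj hB]
    exact measureReal_mono (Set.iUnion_mono fun i => Set.sdiff_subset)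
  have h3 := Finset.sum_le_sum fun i (_ : i ∈ Finset.univ) => h1 i
  rw [Finset.sum_add_distrib] at h3
  linarith

theorem l1Norm_apply {d : ℕ} (x : Fin d → ℝ) : l1Norm d x = ∑ i, |x i| := rfl

theorem l1Norm_sub_one {d : ℕ} {u : Fin d → ℝ} (hu : u ∈ Set.Icc (0 : Fin d → ℝ) 1) :
    l1Norm d (u - 1) = ∑ i, (1 - u i) := by
  rw [l1Norm_apply]
  refine Finset.sum_congr rfl fun i _ => ?_
  have := hu.2 i
  simp only [Pi.one_apply, Pi.sub_apply] at this ⊢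
  rw [abs_of_nonpos (by linarith)]
  ring

theorem one_sub_le_l1Norm_sub_one {d : ℕ} {u : Fin d → ℝ} (hu : u ∈ Set.Icc (0 : Fin d → ℝ) 1)
    (i : Fin d) : 1 - u i ≤ l1Norm d (u - 1) := by
  rw [l1Norm_sub_one hu]
  exact Finset.single_le_sum (f := fun i => 1 - u i)
    (fun j _ => sub_nonneg.2 (hu.2 j)) (Finset.mem_univ i)

/-- The deviation of a copula from `1 - ‖u - 1‖₁` is nonnegative and at most the sum of the
probabilities of the joint exceedances of pairs of coordinates. -/
theorem expansionRemainder_l1Norm_mem_Icc {d : ℕ} {C : (Fin d → ℝ) → ℝ}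
    {μ : Measure (Fin d → ℝ)} [IsProbabilityMeasure μ]
    (hμ : ∀ i, μ.map (fun x => x i) = volume.restrict (Set.Icc (0 : ℝ) 1))
    (hC : ∀ u, C u = μ.real (Set.Iic u)) {u : Fin d → ℝ} (hu : u ∈ Set.Icc (0 : Fin d → ℝ) 1) :
    expansionRemainder C (l1Norm d) u ∈ Set.Icc 0
      (∑ i, ∑ j ∈ Finset.univ.erase i, μ.real {x | u i < x i ∧ u j < x j}) := by
  let A : Fin d → Set (Fin d → ℝ) := fun i => {x | u i < x i}
  have hA : ∀ i, MeasurableSet (A i) := fun i =>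
    measurableSet_lt measurable_const (measurable_pi_apply i)
  have hAμ : ∀ i, μ.real (A i) = 1 - u i := by
    intro i
    have h0 : (0 : ℝ) ≤ u i := hu.1 i
    have h1 : u i ≤ 1 := hu.2 i
    have : A i = (fun x : Fin d → ℝ => x i) ⁻¹' Set.Ioi (u i) := rfl
    rw [this, ← map_measureReal_apply (measurable_pi_apply i) measurableSet_Ioi, hμ,
      measureReal_restrict_apply measurableSet_Ioi]
    have : Set.Ioi (u i) ∩ Set.Icc 0 1 = Set.Ioc (u i) 1 := by
      ext x
      simp only [Set.mem_inter_iff, Set.mem_Ioi, Set.mem_Icc, Set.mem_Ioc]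
      constructor
      · exact fun h => ⟨h.1, h.2.2⟩
      · exact fun h => ⟨h.1, h0.trans h.1.le, h.2⟩
    rw [this, Real.volume_real_Ioc_of_le h1]
  have hcompl : (Set.Iic u)ᶜ = ⋃ i, A i := by
    ext x
    simp [A, Pi.le_def]
  have hCu : C u = 1 - μ.real (⋃ i, A i) := by
    rw [hC, ← hcompl, probReal_compl_eq_one_sub measurableSet_Iic]
    ring
  have hsum : l1Norm d (u - 1) = ∑ i, μ.real (A i) := by
    rw [l1Norm_sub_one hu]
    exact Finset.sum_congr rfl fun i _ => (hAμ i).symm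
  have hlow := sum_measureReal_sub_le_measureReal_iUnion μ A hA
  have hup : μ.real (⋃ i, A i) ≤ ∑ i, μ.real (A i) := measureReal_iUnion_fintype_le A
  rw [expansionRemainder, hCu, hsum]
  refine ⟨by linarith, ?_⟩
  change _ ≤ ∑ i, ∑ j ∈ Finset.univ.erase i, μ.real (A i ∩ A j)
  linarith

/-! ### Existence of a GPC for the ℓ¹ norm. -/

/-- Half-open intervals of length 1 are fundamental domains for ℤ, so they give a ℤ-periodic set the
same measure. -/
theorem map_fract_add_restrict_Ioc (a : ℝ) :
    (volume.restrict (Set.Ioc (0 : ℝ) 1)).map (fun v => Int.fract (v + a)) =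
      volume.restrict (Set.Icc (0 : ℝ) 1) := by
  have hmeas : Measurable fun v : ℝ => Int.fract (v + a) := by fun_prop
  ext s hs
  rw [Measure.map_apply hmeas hs, Measure.restrict_apply (hmeas hs), Measure.restrict_apply hs]
  have hinv : ∀ g : AddSubgroup.zmultiples (1 : ℝ),
      (fun x => g +ᵥ x) ⁻¹' (Int.fract ⁻¹' s) = Int.fract ⁻¹' s := by
    rintro ⟨_, n, rfl⟩
    ext x
    simp [AddSubgroup.vadd_def]
  have hperiod := (isAddFundamentalDomain_Ioc one_pos a).measure_set_eq
    (isAddFundamentalDomain_Ioc one_pos 0) (measurable_fract hs) hinv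
  have hshift : (fun v => Int.fract (v + a)) ⁻¹' s ∩ Set.Ioc 0 1 =
      (fun v => v + a) ⁻¹' (Int.fract ⁻¹' s ∩ Set.Ioc a (a + 1)) := by
    ext v
    simp only [Set.mem_inter_iff, Set.mem_preimage, Set.mem_Ioc]
    constructor <;> rintro ⟨h, h1, h2⟩ <;> exact ⟨h, by linarith, by linarith⟩
  rw [hshift, measure_preimage_add_right, hperiod, zero_add]
  rw [measure_congr ((ae_eq_refl _).inter Ioo_ae_eq_Ioc.symm),
    measure_congr ((ae_eq_refl s).inter Ioo_ae_eq_Icc.symm)]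
  congr 1
  ext x
  simp only [Set.mem_inter_iff, Set.mem_preimage, Set.mem_Ioo, and_congr_left_iff]
  rintro ⟨h0, h1⟩
  rw [Int.fract_eq_self.2 ⟨h0.le, h1⟩]

/-- Two fractional parts above 1 - 1/d differ by less than 1/d; scaling by d leaves an integer in
(-1, 1), so d divides i - j. -/
theorem fract_add_le_of_lt_fract_add {d : ℕ} (hd : 0 < d) {i j : Fin d} (hij : i ≠ j) (v : ℝ)
    (hi : 1 - 1 / (d : ℝ) < Int.fract (v + i / d)) :
    Int.fract (v + j / d) ≤ 1 - 1 / (d : ℝ) := by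
  by_contra! hj
  have hd' : (0 : ℝ) < d := by exact_mod_cast hd
  have hi1 := Int.fract_lt_one (v + i / (d : ℝ))
  have hj1 := Int.fract_lt_one (v + j / (d : ℝ))
  set m := ⌊v + i / (d : ℝ)⌋ with hm
  set n := ⌊v + j / (d : ℝ)⌋ with hn
  rw [Int.fract, ← hm] at hi hi1
  rw [Int.fract, ← hn] at hj hj1
  have e1 : ((i : ℝ) - j) / d - (m - n) < 1 / d := by rw [sub_div]; linarith
  have e2 : -(1 / (d : ℝ)) < ((i : ℝ) - j) / d - (m - n) := by rw [sub_div]; linarith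
  have e3 : ((i : ℝ) - j) - (m - n) * d < 1 := by
    have := mul_lt_mul_of_pos_right e1 hd'
    field_simp at this
    linarith
  have e4 : -1 < ((i : ℝ) - j) - (m - n) * d := by
    have := mul_lt_mul_of_pos_right e2 hd'
    field_simp at this
    linarith
  have e5 : ((i : ℤ) - j) - (m - n) * d < 1 := by exact_mod_cast e3
  have e6 : -1 < ((i : ℤ) - j) - (m - n) * d := by exact_mod_cast e4
  have e7 : ((i : ℤ) - j) = (m - n) * d := by linarith
  have e8 : |(i : ℤ) - j| < d := by
    rw [abs_lt]; constructor <;> have := i.2 <;> have := j.2 <;> omega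
  have e9 : (i : ℤ) - j = 0 := Int.eq_zero_of_abs_lt_dvd ⟨m - n, by rw [e7, mul_comm]⟩ e8
  exact hij (Fin.ext (by omega))

/-- The law of `(fract (V + i / d))_i` with `V` uniformly distributed is a copula that is equal to
`1 - ‖u - 1‖₁` for all `u ≥ 1 - 1 / d`. -/
theorem exists_isCopula_eq_one_sub_l1Norm {d : ℕ} (hd : 0 < d) :
    ∃ C : (Fin d → ℝ) → ℝ, IsCopula C ∧
      ∀ u ∈ Set.Icc (fun _ => 1 - 1 / (d : ℝ)) (1 : Fin d → ℝ), C u = 1 - l1Norm d (u - 1) := by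
  let U : ℝ → Fin d → ℝ := fun v i => Int.fract (v + i / d)
  have hU : Measurable U := measurable_pi_lambda _ fun i => by fun_prop
  have hprob : IsProbabilityMeasure (volume.restrict (Set.Ioc (0 : ℝ) 1)) :=
    ⟨by simp⟩
  let μ : Measure (Fin d → ℝ) := (volume.restrict (Set.Ioc (0 : ℝ) 1)).map U
  have hμ1 : IsProbabilityMeasure μ := Measure.isProbabilityMeasure_map hU.aemeasurable
  have hμ2 : ∀ i, μ.map (fun x => x i) = volume.restrict (Set.Icc (0 : ℝ) 1) := fun i => by
    rw [Measure.map_map (measurable_pi_apply i) hU]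
    exact map_fract_add_restrict_Ioc _
  refine ⟨fun u => μ.real (Set.Iic u), ⟨μ, hμ1, hμ2, fun u => rfl⟩, fun u hu => ?_⟩
  have hd1 : 1 / (d : ℝ) ≤ 1 := by
    rw [div_le_one (by exact_mod_cast hd)]; exact_mod_cast hd
  have hu0 : u ∈ Set.Icc (0 : Fin d → ℝ) 1 := ⟨fun i => (sub_nonneg.2 hd1).trans (hu.1 i), hu.2⟩
  have hr := expansionRemainder_l1Norm_mem_Icc hμ2 (C := fun u => μ.real (Set.Iic u))
    (fun _ => rfl) hu0
  have hzero : ∑ i, ∑ j ∈ Finset.univ.erase i, μ.real {x | u i < x i ∧ u j < x j} = 0 := by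
    refine Finset.sum_eq_zero fun i _ => Finset.sum_eq_zero fun j hj => ?_
    have hempty : U ⁻¹' {x | u i < x i ∧ u j < x j} = ∅ := by
      refine Set.eq_empty_of_forall_notMem fun v hv => ?_
      exact ((hu.1 j).trans_lt hv.2).not_ge
        (fract_add_le_of_lt_fract_add hd (Finset.ne_of_mem_erase hj).symm v
          ((hu.1 i).trans_lt hv.1))
    rw [map_measureReal_apply hU, hempty, measureReal_empty]
    exact (measurableSet_lt measurable_const (measurable_pi_apply i)).inter
      (measurableSet_lt measurable_const (measurable_pi_apply j))
  rw [hzero, Set.Icc_self, Set.mem_singleton_iff] at hr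
  exact sub_eq_zero.1 hr

theorem exists_isGPC_l1Norm {d : ℕ} (hd : 0 < d) :
    ∃ C : (Fin d → ℝ) → ℝ, IsGPC C (l1Norm d) := by
  obtain ⟨C, hC, hCeq⟩ := exists_isCopula_eq_one_sub_l1Norm hd
  have hd' : (0 : ℝ) < d := by exact_mod_cast hd
  have hd1 : 1 / (d : ℝ) ≤ 1 := by
    rw [div_le_one hd']; exact_mod_cast hd
  have hd2 : 0 < 1 / (d : ℝ) := by positivity
  refine ⟨C, hC, ⟨fun x hx => ?_, C, hC, ?_⟩, fun _ => 1 - 1 / (d : ℝ),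
    fun i => ⟨by linarith, by linarith⟩, hCeq⟩
  · rw [l1Norm_apply, Finset.sum_eq_zero_iff_of_nonneg fun i _ => abs_nonneg _] at hx
    exact funext fun i => abs_eq_zero.1 (hx i (Finset.mem_univ i))
  · refine (isLittleO_zero _ _).congr' ?_ EventuallyEq.rfl
    have hnear : ∀ᶠ u : Fin d → ℝ in 𝓝 1, ∀ i, 1 - 1 / (d : ℝ) < u i :=
      eventually_all.2 fun i => (continuous_apply i).continuousAt.eventually_const_lt
        (by simp only [Pi.one_apply]; linarith)
    filter_upwards [self_mem_nhdsWithin, nhdsWithin_le_nhds hnear] with u hu hu'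
    rw [expansionRemainder, hCeq u ⟨fun i => (hu' i).le, hu.2⟩, sub_self]

/-! ### Normal margins and joint tails of pairs. -/

theorem map_stdNormalCDF_gaussianReal :
    (gaussianReal 0 1).map stdNormalCDF = volume.restrict (Set.Icc (0 : ℝ) 1) := by
  have hmeas := continuous_stdNormalCDF.measurable
  have h1 : IsProbabilityMeasure ((gaussianReal 0 1).map stdNormalCDF) :=
    Measure.isProbabilityMeasure_map hmeas.aemeasurable
  have h2 : IsProbabilityMeasure (volume.restrict (Set.Icc (0 : ℝ) 1)) := ⟨by simp⟩
  refine Measure.ext_of_Iic _ _ fun t => ?_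
  rw [Measure.map_apply hmeas measurableSet_Iic, Measure.restrict_apply measurableSet_Iic]
  rcases le_or_gt t 0 with h0 | h0
  · have e1 : stdNormalCDF ⁻¹' Set.Iic t = ∅ :=
      Set.eq_empty_of_forall_notMem fun x hx => (h0.trans_lt (stdNormalCDF_pos x)).not_ge hx
    have e2 : volume (Set.Iic t ∩ Set.Icc 0 1) = 0 :=
      measure_mono_null (t := {0}) (fun x hx => le_antisymm (hx.1.trans h0) hx.2.1) (by simp)
    rw [e1, e2, measure_empty]
  rcases le_or_gt 1 t with h1 | h1
  · have e1 : stdNormalCDF ⁻¹' Set.Iic t = Set.univ :=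
      Set.eq_univ_of_forall fun x => (stdNormalCDF_lt_one x).le.trans h1
    have e2 : Set.Iic t ∩ Set.Icc 0 1 = Set.Icc 0 1 :=
      Set.inter_eq_right.2 fun x hx => hx.2.trans h1
    rw [e1, e2]
    simp
  · obtain ⟨s, rfl⟩ := exists_stdNormalCDF_eq h0 h1
    have e1 : stdNormalCDF ⁻¹' Set.Iic (stdNormalCDF s) = Set.Iic s := by
      ext x
      exact strictMono_stdNormalCDF.le_iff_le
    have e2 : Set.Iic (stdNormalCDF s) ∩ Set.Icc 0 1 = Set.Icc 0 (stdNormalCDF s) := by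
      ext x
      simp only [Set.mem_inter_iff, Set.mem_Iic, Set.mem_Icc]
      exact ⟨fun h => ⟨h.2.1, h.1⟩, fun h => ⟨h.2, h.1, h.2.trans h1.le⟩⟩
    rw [e1, e2, Real.volume_Icc, sub_zero, stdNormalCDF, ofReal_cdf]

/-- The Chernoff bound for the joint exceedances of a bivariate normal vector. -/
theorem measureReal_lt_and_lt_le_exp {Ω : Type*} [MeasurableSpace Ω]
    {P : Measure Ω} {X Y : Ω → ℝ} {r s : ℝ}
    (hXY : HasGaussianLaw (fun ω => (X ω, Y ω)) P)
    (hX : ∫ ω, X ω ∂P = 0) (hY : ∫ ω, Y ω ∂P = 0) (hXX : covariance X X P = 1)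
    (hYY : covariance Y Y P = 1) (hcov : covariance X Y P = r) (hr : -1 < r) (hs : 0 ≤ s) :
    P.real {ω | s < X ω ∧ s < Y ω} ≤ Real.exp (-(s ^ 2 / (1 + r))) := by
  have : IsProbabilityMeasure P := hXY.isProbabilityMeasure
  have hX2 := hXY.fst.memLp_two
  have hY2 := hXY.snd.memLp_two
  have hvar : variance (X + Y) P = 2 * (1 + r) := by
    rw [variance_add hX2 hY2, ← covariance_self hXY.fst.aemeasurable,
      ← covariance_self hXY.snd.aemeasurable, hXX, hYY, hcov]
    ring
  have hmean : ∫ ω, (X + Y) ω ∂P = 0 := by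
    simp only [Pi.add_apply]
    rw [integral_add hXY.fst.integrable hXY.snd.integrable, hX, hY, add_zero]
  have hlaw := hXY.add.map_eq_gaussianReal
  rw [hmean, hvar] at hlaw
  have hr' : 0 < 1 + r := by linarith
  -- The parameter s/(1 + r) minimises the Chernoff exponent -2sλ + (1 + r)λ².
  have hint : Integrable (fun ω => Real.exp (s / (1 + r) * (X + Y) ω)) P := by
    have h := integrable_exp_mul_gaussianReal (μ := 0) (v := (2 * (1 + r)).toNNReal) (s / (1 + r))
    rw [← hlaw] at h
    exact h.comp_aemeasurable hXY.add.aemeasurable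
  have hch := measure_ge_le_exp_mul_mgf (2 * s) (div_nonneg hs hr'.le) hint
  rw [mgf_gaussianReal hlaw, Real.coe_toNNReal _ (by linarith), ← Real.exp_add] at hch
  refine (measureReal_mono fun ω hω => ?_).trans (hch.trans_eq ?_)
  · have h1 := hω.1
    have h2 := hω.2
    simp only [Set.mem_ofPred_eq, Pi.add_apply]
    linarith
  · congr 1
    field_simp
    ring

theorem exists_measureReal_stdNormalCDF_le_rpow {Ω : Type*} [MeasurableSpace Ω]
    {P : Measure Ω} {X Y : Ω → ℝ} {r : ℝ}
    (hXY : HasGaussianLaw (fun ω => (X ω, Y ω)) P)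
    (hX : ∫ ω, X ω ∂P = 0) (hY : ∫ ω, Y ω ∂P = 0) (hXX : covariance X X P = 1)
    (hYY : covariance Y Y P = 1) (hcov : covariance X Y P = r) (hr : -1 < r) (hr0 : r < 0) :
    ∃ K : ℝ, 0 ≤ K ∧ ∀ t, stdNormalCDF 0 ≤ t → t ≤ 1 →
      P.real {ω | t < stdNormalCDF (X ω) ∧ t < stdNormalCDF (Y ω)} ≤
        K * (1 - t) ^ (1 + r ^ 2 / (1 - r ^ 2)) := by
  obtain ⟨c, hc, htail⟩ := exists_mul_exp_le_one_sub_stdNormalCDF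
  have hr2 : 0 < 1 - r ^ 2 := by nlinarith
  set p := 1 + r ^ 2 / (1 - r ^ 2) with hp
  have hp' : p = 1 / (1 - r ^ 2) := by rw [hp]; field_simp; ring
  have hp0 : 0 ≤ p := by rw [hp']; positivity
  refine ⟨c⁻¹ ^ p, by positivity, fun t ht0 ht1 => ?_⟩
  -- The level 1 has no normal quantile, but it is never exceeded.
  rcases ht1.eq_or_lt with rfl | ht1
  · have : {ω | 1 < stdNormalCDF (X ω) ∧ 1 < stdNormalCDF (Y ω)} = ∅ :=
      Set.eq_empty_of_forall_notMem fun ω hω => hω.1.not_gt (stdNormalCDF_lt_one _)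
    rw [this, measureReal_empty]
    positivity
  obtain ⟨s, rfl⟩ := exists_stdNormalCDF_eq ((stdNormalCDF_pos 0).trans_le ht0) ht1
  have hs : 0 ≤ s := strictMono_stdNormalCDF.le_iff_le.1 ht0
  simp only [strictMono_stdNormalCDF.lt_iff_lt]
  refine (measureReal_lt_and_lt_le_exp hXY hX hY hXX hYY hcov hr hs).trans ?_
  rw [← Real.mul_rpow (by positivity) (by linarith)]
  have h1 : Real.exp (-s ^ 2) ≤ c⁻¹ * (1 - stdNormalCDF s) := by
    rw [inv_mul_eq_div, le_div_iff₀' hc]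
    exact htail s hs
  refine le_trans ?_ (Real.rpow_le_rpow (Real.exp_pos _).le h1 hp0)
  rw [← Real.exp_mul, hp', mul_one_div, neg_div]
  -- What remains is 0 < 1 + r ≤ 1 - r², that is r(1 + r) ≤ 0: negative correlation enters here.
  gcongr
  · linarith
  · nlinarith

/-! ### The normal copula. -/

theorem mainTheorem8 {Ω : Type*} [MeasurableSpace Ω] (P : Measure Ω) [IsProbabilityMeasure P]
    (d : ℕ) (hd : 2 ≤ d)
    -- the normal random vector with mean `0` and covariance matrix `ρ`
    (X : Fin d → Ω → ℝ) (ρ : Matrix (Fin d) (Fin d) ℝ)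
    (hX : HasGaussianLaw (fun ω i => X i ω) P)
    (hmean : ∀ i, ∫ ω, X i ω ∂P = 0)
    (hcov : ∀ i j, covariance (X i) (X j) P = ρ i j)
    (hdiag : ∀ i, ρ i i = 1)
    (hρ : ∀ i j, i ≠ j → -1 < ρ i j ∧ ρ i j < 0)
    -- its copula
    (C : (Fin d → ℝ) → ℝ)
    (hC : ∀ u, C u = P.real {ω | ∀ i, stdNormalCDF (X i ω) ≤ u i})
    (δ : ℝ)
    (hδ : IsLeast {r : ℝ | ∃ i j : Fin d, i ≠ j ∧ r = ρ i j ^ 2 / (1 - ρ i j ^ 2)} δ) :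
    InDeltaNeighborhood C (l1Norm d) δ := by
  have hmeas := continuous_stdNormalCDF.measurable
  have hXm : ∀ i, AEMeasurable (X i) P := fun i => (hX.eval i).aemeasurable
  let U : Ω → Fin d → ℝ := fun ω i => stdNormalCDF (X i ω)
  have hU : AEMeasurable U P := aemeasurable_pi_lambda _ fun i => hmeas.comp_aemeasurable (hXm i)
  let μ : Measure (Fin d → ℝ) := P.map U
  have hμ1 : IsProbabilityMeasure μ := Measure.isProbabilityMeasure_map hU
  have hμ2 : ∀ i, μ.map (fun x => x i) = volume.restrict (Set.Icc (0 : ℝ) 1) := by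
    intro i
    have hlaw : P.map (X i) = gaussianReal 0 1 := by
      rw [(hX.eval i).map_eq_gaussianReal, hmean, ← covariance_self (hXm i), hcov, hdiag,
        Real.toNNReal_one]
    rw [AEMeasurable.map_map_of_aemeasurable (measurable_pi_apply i).aemeasurable hU,
      ← map_stdNormalCDF_gaussianReal, ← hlaw,
      AEMeasurable.map_map_of_aemeasurable hmeas.aemeasurable (hXm i)]
    rfl
  have hμ3 : ∀ u, C u = μ.real (Set.Iic u) := by
    intro u
    rw [hC, map_measureReal_apply_of_aemeasurable hU measurableSet_Iic]
    rfl
  have hδpos : 0 < δ := by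
    obtain ⟨i, j, hij, rfl⟩ := hδ.1
    obtain ⟨h1, h2⟩ := hρ i j hij
    have : 0 < 1 - ρ i j ^ 2 := by nlinarith
    have : 0 < ρ i j ^ 2 := by nlinarith
    positivity
  refine ⟨⟨μ, hμ1, hμ2, hμ3⟩, exists_isGPC_l1Norm (by omega), hδpos, ?_⟩
  have hpair : ∀ i j, ∃ K : ℝ, 0 ≤ K ∧ (i ≠ j → ∀ t, stdNormalCDF 0 ≤ t → t ≤ 1 →
      P.real {ω | t < stdNormalCDF (X i ω) ∧ t < stdNormalCDF (X j ω)} ≤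
        K * (1 - t) ^ (1 + ρ i j ^ 2 / (1 - ρ i j ^ 2))) := by
    intro i j
    by_cases hij : i = j
    · exact ⟨0, le_rfl, fun h => absurd hij h⟩
    · obtain ⟨K, hK, h⟩ := exists_measureReal_stdNormalCDF_le_rpow (hX.prodMk i j) (hmean i)
        (hmean j) ((hcov i i).trans (hdiag i)) ((hcov j j).trans (hdiag j)) (hcov i j)
        (hρ i j hij).1 (hρ i j hij).2
      exact ⟨K, hK, fun _ => h⟩
  choose K hK0 hK using hpair
  refine IsBigO.of_bound (∑ i, ∑ j ∈ Finset.univ.erase i, K i j) ?_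
  have hnear : ∀ᶠ u : Fin d → ℝ in 𝓝 1, ∀ i, stdNormalCDF 0 < u i :=
    eventually_all.2 fun i => (continuous_apply i).continuousAt.eventually_const_lt
      (stdNormalCDF_lt_one 0)
  have hN : Continuous fun u : Fin d → ℝ => l1Norm d (u - 1) := by
    simp only [l1Norm_apply]
    fun_prop
  -- Below 1, lowering the exponent to 1 + δ only increases the power.
  have hnear1 : ∀ᶠ u : Fin d → ℝ in 𝓝 1, l1Norm d (u - 1) < 1 :=
    hN.continuousAt.eventually_lt_const (by simp)
  filter_upwards [self_mem_nhdsWithin, nhdsWithin_le_nhds hnear, nhdsWithin_le_nhds hnear1]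
    with u hu hu0 hu1
  have hN0 : 0 ≤ l1Norm d (u - 1) := apply_nonneg _ _
  have hr := expansionRemainder_l1Norm_mem_Icc hμ2 hμ3 hu
  rw [Real.norm_of_nonneg hr.1, Real.norm_of_nonneg (by positivity), Finset.sum_mul]
  refine hr.2.trans (Finset.sum_le_sum fun i _ => ?_)
  rw [Finset.sum_mul]
  refine Finset.sum_le_sum fun j hj => ?_
  have hij : i ≠ j := (Finset.ne_of_mem_erase hj).symm
  have hδij : δ ≤ ρ i j ^ 2 / (1 - ρ i j ^ 2) := hδ.2 ⟨i, j, hij, rfl⟩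
  have hmin1 : min (u i) (u j) ≤ 1 := (min_le_left _ _).trans (hu.2 i)
  have hminN : 1 - min (u i) (u j) ≤ l1Norm d (u - 1) := by
    rcases min_choice (u i) (u j) with h | h <;> rw [h] <;>
      exact one_sub_le_l1Norm_sub_one hu _
  have hset : MeasurableSet {x : Fin d → ℝ | u i < x i ∧ u j < x j} :=
    (measurableSet_lt measurable_const (measurable_pi_apply i)).inter
      (measurableSet_lt measurable_const (measurable_pi_apply j))
  rw [map_measureReal_apply_of_aemeasurable hU hset]
  -- The tail bound needs one common level: the smaller of u i and u j.
  calc P.real (U ⁻¹' {x | u i < x i ∧ u j < x j})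
      ≤ P.real {ω | min (u i) (u j) < stdNormalCDF (X i ω) ∧
          min (u i) (u j) < stdNormalCDF (X j ω)} :=
        measureReal_mono fun ω hω =>
          ⟨(min_le_left _ _).trans_lt hω.1, (min_le_right _ _).trans_lt hω.2⟩
    _ ≤ K i j * (1 - min (u i) (u j)) ^ (1 + ρ i j ^ 2 / (1 - ρ i j ^ 2)) :=
        hK i j hij _ (le_min (hu0 i).le (hu0 j).le) hmin1
    _ ≤ K i j * l1Norm d (u - 1) ^ (1 + ρ i j ^ 2 / (1 - ρ i j ^ 2)) :=
        mul_le_mul_of_nonneg_left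
          (Real.rpow_le_rpow (sub_nonneg.2 hmin1) hminN (by linarith)) (hK0 i j)
    _ ≤ K i j * l1Norm d (u - 1) ^ (1 + δ) :=
        mul_le_mul_of_nonneg_left
          (Real.rpow_le_rpow_of_exponent_ge' hN0 hu1.le (by linarith) (by linarith)) (hK0 i j)
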